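/- Let $\mathcal U=\{u_1,\dots,u_n\}$ be a universe and call an indexed family $\mathcal S=(S_1,\dots,S_m)$ of subsets of $\mathcal U$ a set system. Two set systems are edge-neighbors if they differ in exactly one set $S_i$, and the two versions of $S_i$ differ by exactly one element. A randomized mechanism $\mathcal M$ is $\epsilon$-edge differentially private if $\Pr[\mathcal M(\mathcal S)\in Y]\le e^{\epsilon}\Pr[\mathcal M(\mathcal S')\in Y]$ for all edge-neighbors $\mathcal S,\mathcal S'$ and all sets $Y$ of outputs. An implicit set cover is an ordering of the $m$ sets; the cover implied by it consists of all sets that are the first set, in this ordering, containing some element $u\in\bigcup_i S_i$. Let $\mathrm{OPT}(\mathcal S)$ be the minimum number of sets of $\mathcal S$ whose union is $\bigcup_i S_i$. Theorem. There is an absolute constant $C>0$ such that for all $n\ge 2$, $m\ge 0$ and $\epsilon>0$ there is an $\epsilon$-edge differentially private mechanism that maps every set system with $n$ elements and $m$ sets to a random ordering of its sets such that, for every input $\mathcal S$, with probability at least $1-1/n^2$ the implied set cover has size at most $$C\left(\log n+\frac{\log^3(n+m)}{\epsilon}\right)\cdot \mathrm{OPT}(\mathcal S).$$ (In particular, for $m\le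 n^{O(1)}$ and $\epsilon\le 1$ this is $O(\mathrm{polylog}(n)/\epsilon)\cdot\mathrm{OPT}(\mathcal S)$.) -/

import Mathlib

/-- A set system `S_1, …, S_m` over the universe `{u_1, …, u_n}`: an indexed family of sets
(equivalently, a bipartite graph between elements and sets). -/
abbrev SetSystem (n m : ℕ) : Type := Fin m → Finset (Fin n)

namespace SetSystem

/-- Two set systems are edge-neighbors if they differ in exactly one set, and the two versions of
that set differ by exactly one element. -/
def EdgeNeighbors {n m : ℕ} (S T : SetSystem n m) : Prop :=
  ∃ i : Fin m, (symmDiff (S i) (T i)).card = 1 ∧ ∀ j : Fin m, j ≠ i → S j = T j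

/-- A randomized mechanism on set systems, with a discrete output space `Y`, is `ε`-edge
differentially private if `Pr[M(S) ∈ A] ≤ exp(ε) * Pr[M(T) ∈ A]` for all edge-neighbors `S`, `T`
and every set `A` of outputs. -/
def IsEdgeDP {n m : ℕ} {Y : Type*} (ε : ℝ) (M : SetSystem n m → PMF Y) : Prop :=
  ∀ S T : SetSystem n m, EdgeNeighbors S T → ∀ A : Set Y,
    (M S).toOuterMeasure A ≤ ENNReal.ofReal (Real.exp ε) * (M T).toOuterMeasure A

/-- The sets with index in `C` cover every element that lies in some set of the system. -/
def IsCover {n m : ℕ} (S : SetSystem n m) (C : Finset (Fin m)) : Prop :=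
  ∀ u : Fin n, (∃ i, u ∈ S i) → ∃ i ∈ C, u ∈ S i

/-- The minimum number of sets in a set cover. -/
noncomputable def opt {n m : ℕ} (S : SetSystem n m) : ℕ :=
  sInf {k : ℕ | ∃ C : Finset (Fin m), S.IsCover C ∧ C.card = k}

/-- In the ordering `S_{σ 0}, S_{σ 1}, …` of the sets, `S_i` is the first set containing `u`. -/
def IsFirst {n m : ℕ} (S : SetSystem n m) (σ : Equiv.Perm (Fin m)) (u : Fin n) (i : Fin m) :
    Prop :=
  u ∈ S i ∧ ∀ j : Fin m, u ∈ S j → σ.symm i ≤ σ.symm j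

open Classical in
/-- The set cover implied by the ordering `S_{σ 0}, S_{σ 1}, …`: all sets that are the first set
containing some element. -/
noncomputable def implicitCover {n m : ℕ} (S : SetSystem n m) (σ : Equiv.Perm (Fin m)) :
    Finset (Fin m) :=
  Finset.univ.filter fun i => ∃ u : Fin n, S.IsFirst σ u i

end SetSystem

/-! The mechanism is the exponential mechanism on orderings, scored by the size of the implied set
cover. This size changes by at most one between edge-neighbors, and a uniformly random ordering
starts with the sets of an optimal cover of size `k` with probability at least `m ^ (-k)`. -/

section ExponentialMechanism

/-! Let `k` be the optimum. Orderings of cost above `t` have total weight at most `m! * exp (-ε t /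
2)`, while those starting with an optimal cover cost at most `k` and so have weight at least `m! * m
^ (-k) * exp (-ε k / 2)`. The failure probability is thus at most `m ^ k * exp (-ε (t - k) / 2)`,
which drops below `1 / n ^ 2` once `t - k` reaches `(2 / ε) * (k log m + 2 log n)`. For `k ≥ 1` a
single logarithm over `ε` would suffice; the cube is slack. -/

theorem sum_exp_le_of_le_add_one {α : Type*} {ε : ℝ} (hε : 0 ≤ ε) {f g : α → ℝ} (h : ∀ a, g a ≤ f a + 1)
    (s : Finset α) :
    ∑ a ∈ s, Real.exp (-(ε / 2 * f a)) ≤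
      Real.exp (ε / 2) * ∑ a ∈ s, Real.exp (-(ε / 2 * g a)) := by
  rw [Finset.mul_sum]
  refine Finset.sum_le_sum fun a _ => ?_
  rw [← Real.exp_add, Real.exp_le_exp]
  nlinarith [h a]

variable {α : Type*} [Fintype α] [Nonempty α]

/-- The normalizing constant of the exponential mechanism with cost function `f`. -/
noncomputable def expPartition (ε : ℝ) (f : α → ℝ) : ℝ := ∑ a, Real.exp (-(ε / 2 * f a))

theorem expPartition_pos (ε : ℝ) (f : α → ℝ) : 0 < expPartition ε f :=
  Finset.sum_pos (fun _ _ => Real.exp_pos _) Finset.univ_nonempty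

/-- The exponential mechanism: `a` is drawn with probability proportional to
`exp (-(ε / 2) * f a)`. -/
noncomputable def expMechanism (ε : ℝ) (f : α → ℝ) : PMF α :=
  PMF.ofFintype (fun a => ENNReal.ofReal (Real.exp (-(ε / 2 * f a)) / expPartition ε f)) <| by
    have hZ := expPartition_pos ε f
    rw [← ENNReal.ofReal_sum_of_nonneg fun a _ => by positivity, ← Finset.sum_div]
    change ENNReal.ofReal (expPartition ε f / expPartition ε f) = 1
    rw [div_self hZ.ne', ENNReal.ofReal_one]

open Classical in
theorem expMechanism_toOuterMeasure (ε : ℝ) (f : α → ℝ) (A : Set α) :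
    (expMechanism ε f).toOuterMeasure A =
      ENNReal.ofReal ((∑ a with a ∈ A, Real.exp (-(ε / 2 * f a))) / expPartition ε f) := by
  have hZ := expPartition_pos ε f
  rw [PMF.toOuterMeasure_apply_fintype, Finset.sum_div,
    ENNReal.ofReal_sum_of_nonneg fun a _ => by positivity, Finset.sum_filter]
  rfl

/-- The exponential mechanism is private when the cost function has sensitivity one. -/
theorem expMechanism_private {ε : ℝ} (hε : 0 ≤ ε) {f g : α → ℝ} (hfg : ∀ a, f a ≤ g a + 1)
    (hgf : ∀ a, g a ≤ f a + 1) (A : Set α) :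
    (expMechanism ε f).toOuterMeasure A ≤
      ENNReal.ofReal (Real.exp ε) * (expMechanism ε g).toOuterMeasure A := by
  classical
  have hf := expPartition_pos ε f
  have hg := expPartition_pos ε g
  rw [expMechanism_toOuterMeasure, expMechanism_toOuterMeasure,
    ← ENNReal.ofReal_mul (Real.exp_pos _).le]
  refine ENNReal.ofReal_le_ofReal ?_
  rw [mul_div_assoc', div_le_div_iff₀ hf hg]
  -- The weight of `A` and the normalizer each change by a factor of at most `exp (ε / 2)`.
  have h1 := sum_exp_le_of_le_add_one hε hgf (Finset.univ.filter (· ∈ A))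
  have h2 : expPartition ε g ≤ Real.exp (ε / 2) * expPartition ε f :=
    sum_exp_le_of_le_add_one hε hfg Finset.univ
  have h3 : Real.exp ε = Real.exp (ε / 2) * Real.exp (ε / 2) := by
    rw [← Real.exp_add, add_halves]
  refine (mul_le_mul h1 h2 hg.le (by positivity)).trans_eq ?_
  rw [h3]
  ring

/-- If a `1 / r` fraction of the outcomes has cost at most `k`, then the exponential mechanism
exceeds cost `t` with probability at most `r * exp (-(ε / 2) * (t - k))`. -/
theorem expMechanism_utility {ε : ℝ} (hε : 0 ≤ ε) {f : α → ℝ} {k r t : ℝ} (G : Finset α)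
    (hr : 0 ≤ r) (hG : ∀ a ∈ G, f a ≤ k) (hcard : (Fintype.card α : ℝ) ≤ r * G.card) :
    ENNReal.ofReal (1 - r * Real.exp (-(ε / 2 * (t - k)))) ≤
      (expMechanism ε f).toOuterMeasure {a | f a ≤ t} := by
  classical
  have hZ := expPartition_pos ε f
  rw [expMechanism_toOuterMeasure]
  refine ENNReal.ofReal_le_ofReal ?_
  rw [le_div_iff₀ hZ]
  have hsplit := Finset.sum_filter_add_sum_filter_not Finset.univ (fun a => a ∈ {a | f a ≤ t})
    fun a => Real.exp (-(ε / 2 * f a))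
  change _ = expPartition ε f at hsplit
  have hbad : ∑ a with a ∉ {a | f a ≤ t}, Real.exp (-(ε / 2 * f a)) ≤
      Fintype.card α * Real.exp (-(ε / 2 * t)) := by
    refine (Finset.sum_le_card_nsmul _ _ (Real.exp (-(ε / 2 * t))) fun a ha => ?_).trans ?_
    · have hlt : t < f a := by simpa using ha
      rw [Real.exp_le_exp]
      nlinarith
    · rw [nsmul_eq_mul]
      gcongr
      exact Finset.card_le_univ _
  have hgood : G.card * Real.exp (-(ε / 2 * k)) ≤ expPartition ε f := by
    rw [← nsmul_eq_mul]
    refine (Finset.card_nsmul_le_sum G (fun a => Real.exp (-(ε / 2 * f a))) _ fun a ha => ?_).trans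
      (Finset.sum_le_univ_sum_of_nonneg fun a => (Real.exp_pos _).le)
    rw [Real.exp_le_exp]
    nlinarith [hG a ha]
  have hexp : Real.exp (-(ε / 2 * t)) =
      Real.exp (-(ε / 2 * k)) * Real.exp (-(ε / 2 * (t - k))) := by
    rw [← Real.exp_add]
    ring_nf
  have hkey : Fintype.card α * Real.exp (-(ε / 2 * t)) ≤
      r * Real.exp (-(ε / 2 * (t - k))) * expPartition ε f := by
    calc Fintype.card α * Real.exp (-(ε / 2 * t))
        ≤ r * G.card * Real.exp (-(ε / 2 * t)) := by gcongr
      _ = r * Real.exp (-(ε / 2 * (t - k))) * (G.card * Real.exp (-(ε / 2 * k))) := by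
        rw [hexp]; ring
      _ ≤ _ := by gcongr
  linarith

end ExponentialMechanism

namespace SetSystem

variable {n m : ℕ}

theorem EdgeNeighbors.symm {S T : SetSystem n m} (h : EdgeNeighbors S T) : EdgeNeighbors T S := by
  obtain ⟨i, hi, hj⟩ := h
  exact ⟨i, by rwa [symmDiff_comm], fun j hji => (hj j hji).symm⟩

/-- Changing one edge affects a single element, and an element has at most one first set; hence
sensitivity one. -/
theorem EdgeNeighbors.exists_mem_iff {S T : SetSystem n m} (h : EdgeNeighbors S T) :
    ∃ u, ∀ v, v ≠ u → ∀ j, v ∈ S j ↔ v ∈ T j := by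
  obtain ⟨i, hi, hj⟩ := h
  obtain ⟨u, hu⟩ := Finset.card_eq_one.1 hi
  refine ⟨u, fun v hv j => ?_⟩
  by_cases hji : j = i
  · subst hji
    have hmem : v ∉ symmDiff (S j) (T j) := by simpa [hu] using hv
    rw [Finset.mem_symmDiff] at hmem
    tauto
  · rw [hj j hji]

theorem IsFirst.unique {S : SetSystem n m} {σ : Equiv.Perm (Fin m)} {u : Fin n} {i j : Fin m}
    (hi : S.IsFirst σ u i) (hj : S.IsFirst σ u j) : i = j :=
  σ.symm.injective (le_antisymm (hi.2 j hj.1) (hj.2 i hi.1))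

/-- The size of the implied set cover has sensitivity one. -/
theorem EdgeNeighbors.card_implicitCover_le {S T : SetSystem n m} (h : EdgeNeighbors S T)
    (σ : Equiv.Perm (Fin m)) : (S.implicitCover σ).card ≤ (T.implicitCover σ).card + 1 := by
  classical
  obtain ⟨u, hu⟩ := h.exists_mem_iff
  have hsub : S.implicitCover σ ⊆
      T.implicitCover σ ∪ Finset.univ.filter fun i => S.IsFirst σ u i := by
    intro i hi
    obtain ⟨v, hv⟩ := (Finset.mem_filter.1 hi).2
    by_cases hvu : v = u
    · subst hvu
      exact Finset.mem_union_right _ (Finset.mem_filter.2 ⟨Finset.mem_univ _, hv⟩)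
    · refine Finset.mem_union_left _ (Finset.mem_filter.2 ⟨Finset.mem_univ _, v, ?_⟩)
      exact ⟨(hu v hvu i).1 hv.1, fun j hj => hv.2 j ((hu v hvu j).2 hj)⟩
  refine (Finset.card_le_card hsub).trans ((Finset.card_union_le _ _).trans ?_)
  gcongr
  refine Finset.card_le_one.2 fun i hi j hj => ?_
  exact (Finset.mem_filter.1 hi).2.unique (Finset.mem_filter.1 hj).2

theorem exists_isCover_card_eq_opt (S : SetSystem n m) :
    ∃ C : Finset (Fin m), S.IsCover C ∧ C.card = S.opt :=
  Nat.sInf_mem (s := {k : ℕ | ∃ C : Finset (Fin m), S.IsCover C ∧ C.card = k})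
    ⟨_, Finset.univ, fun _ ⟨i, hi⟩ => ⟨i, Finset.mem_univ i, hi⟩, rfl⟩

/-- The sets in the first `k` places of an ordering. -/
def firstSets (k : ℕ) (σ : Equiv.Perm (Fin m)) : Finset (Fin m) :=
  Finset.univ.filter fun i => (σ.symm i : ℕ) < k

theorem card_firstSets {k : ℕ} (hk : k ≤ m) (σ : Equiv.Perm (Fin m)) :
    (firstSets k σ).card = k := by
  have hmap : firstSets k σ = (Finset.univ.filter fun i : Fin m => (i : ℕ) < k).map
      σ.toEmbedding := by
    ext i
    simp [firstSets, Finset.mem_map_equiv]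
  rw [hmap, Finset.card_map, Fin.card_filter_val_lt, min_eq_right hk]

/-- If an ordering starts with the sets of a cover, it implies a subset of this cover. -/
theorem implicitCover_subset {S : SetSystem n m} {C : Finset (Fin m)} (hC : S.IsCover C)
    {k : ℕ} {σ : Equiv.Perm (Fin m)} (hσ : firstSets k σ = C) : S.implicitCover σ ⊆ C := by
  classical
  intro i hi
  obtain ⟨u, hu, hmin⟩ := (Finset.mem_filter.1 hi).2
  obtain ⟨j, hjC, hj⟩ := hC u ⟨i, hu⟩
  rw [← hσ] at hjC ⊢
  refine Finset.mem_filter.2 ⟨Finset.mem_univ _, ?_⟩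
  exact lt_of_le_of_lt (hmin j hj) (Finset.mem_filter.1 hjC).2

/-- At least a fraction `m ^ (-k)` of all orderings starts with a given collection of `k` sets. -/
theorem card_perm_le (C : Finset (Fin m)) :
    Fintype.card (Equiv.Perm (Fin m)) ≤
      (Finset.univ.filter fun σ => firstSets C.card σ = C).card * m ^ C.card := by
  have hCm : C.card ≤ m := by simpa using Finset.card_le_univ C
  have hmaps : ∀ σ ∈ (Finset.univ : Finset (Equiv.Perm (Fin m))),
      firstSets C.card σ ∈ Finset.powersetCard C.card Finset.univ := fun σ _ =>
    Finset.mem_powersetCard.2 ⟨Finset.subset_univ _, card_firstSets hCm σ⟩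
  -- Orderings are classed by their initial `C.card`-set. A permutation carrying `D` onto `C`
  -- injects the class of `D` into that of `C`, and there are at most `m ^ C.card` classes.
  refine (Finset.card_le_mul_card_image_of_maps_to hmaps _ fun D hD => ?_).trans
    (Nat.mul_le_mul_left _ ?_)
  · have hDC : D.card = C.card := (Finset.mem_powersetCard.1 hD).2
    let e : {i // i ∈ D} ≃ {i // i ∈ C} := Finset.equivOfCardEq hDC
    let π : Equiv.Perm (Fin m) := e.extendSubtype
    have hπ : ∀ i, π i ∈ C ↔ i ∈ D := fun i =>
      ⟨fun h => by_contra fun hi => e.extendSubtype_not_mem i hi h, e.extendSubtype_mem i⟩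
    refine Finset.card_le_card_of_injOn (fun σ => π * σ) (fun σ hσ => ?_)
      fun σ _ τ _ h => mul_left_cancel h
    have hσD : firstSets C.card σ = D := (Finset.mem_filter.1 hσ).2
    refine Finset.mem_coe.2 (Finset.mem_filter.2 ⟨Finset.mem_univ _, ?_⟩)
    ext i
    change i ∈ firstSets C.card (π * σ) ↔ i ∈ C
    have hi := hπ (π.symm i)
    rw [Equiv.apply_symm_apply, ← hσD] at hi
    rw [hi]
    simp only [firstSets, Finset.mem_filter, Finset.mem_univ, true_and]
    rfl
  · rw [Finset.card_powersetCard, Finset.card_univ, Fintype.card_fin]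
    exact Nat.choose_le_pow m C.card

theorem implicitCover_eq_empty {S : SetSystem n m} (h : S.opt = 0) (σ : Equiv.Perm (Fin m)) :
    S.implicitCover σ = ∅ := by
  obtain ⟨C, hC, hcard⟩ := S.exists_isCover_card_eq_opt
  obtain rfl : C = ∅ := Finset.card_eq_zero.1 (hcard.trans h)
  exact Finset.subset_empty.1 (implicitCover_subset hC (k := 0) (by simp [firstSets]))

end SetSystem

theorem mainTheorem3 :
    ∃ C : ℝ, 0 < C ∧
      ∀ (n m : ℕ) (ε : ℝ), 2 ≤ n → 0 < ε →
        ∃ M : SetSystem n m → PMF (Equiv.Perm (Fin m)),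
          SetSystem.IsEdgeDP ε M ∧
          ∀ S : SetSystem n m,
            ENNReal.ofReal (1 - 1 / (n : ℝ) ^ 2) ≤
              (M S).toOuterMeasure
                {σ : Equiv.Perm (Fin m) | ((S.implicitCover σ).card : ℝ) ≤
                  C * (Real.log n + Real.log (n + m) ^ 3 / ε) * (S.opt : ℝ)} := by
  classical
  refine ⟨6, by norm_num, fun n m ε hn hε =>
    ⟨fun S => expMechanism ε fun σ => ((S.implicitCover σ).card : ℝ), ?_, fun S => ?_⟩⟩
  · intro S T h A
    exact expMechanism_private hε.le (fun σ => by exact_mod_cast h.card_implicitCover_le σ)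
      (fun σ => by exact_mod_cast h.symm.card_implicitCover_le σ) A
  obtain ⟨C, hC, hcard⟩ := S.exists_isCover_card_eq_opt
  have hn' : (2 : ℝ) ≤ n := by exact_mod_cast hn
  have hutil := fun t => expMechanism_utility (t := t) hε.le (k := (S.opt : ℝ))
    (f := fun σ => ((S.implicitCover σ).card : ℝ)) (r := (m : ℝ) ^ S.opt)
    (Finset.univ.filter fun σ => SetSystem.firstSets C.card σ = C) (by positivity)
    (fun σ hσ => by
      rw [← hcard]
      exact_mod_cast Finset.card_le_card
        (SetSystem.implicitCover_subset hC (Finset.mem_filter.1 hσ).2))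
    (by rw [← hcard, mul_comm]; exact_mod_cast SetSystem.card_perm_le C)
  -- With optimum `0` the bound is `0`, and it holds surely. Otherwise `k ≥ 1`, which lets `k * L ^
  -- 3` dominate `log n`.
  rcases Nat.eq_zero_or_pos S.opt with h0 | hpos
  · have huniv : {σ : Equiv.Perm (Fin m) | ((S.implicitCover σ).card : ℝ) ≤
        6 * (Real.log n + Real.log (n + m) ^ 3 / ε) * (S.opt : ℝ)} = Set.univ := by
      ext σ
      simp [h0, SetSystem.implicitCover_eq_empty h0]
    rw [huniv, (PMF.toOuterMeasure_apply_eq_one_iff _ _).2 (Set.subset_univ _),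
      ENNReal.ofReal_le_one]
    have : 0 ≤ 1 / (n : ℝ) ^ 2 := by positivity
    linarith
  have hm : 1 ≤ m := by
    have : C.card ≤ m := by simpa using Finset.card_le_univ C
    omega
  have hm' : (1 : ℝ) ≤ m := by exact_mod_cast hm
  have hk : (1 : ℝ) ≤ S.opt := by exact_mod_cast hpos
  refine le_trans (ENNReal.ofReal_le_ofReal ?_) (hutil _)
  set k : ℝ := (S.opt : ℝ) with hkdef
  set L := Real.log (n + m) with hL
  have hLn : Real.log n ≤ L := Real.log_le_log (by linarith) (by linarith)
  have hLm : Real.log m ≤ L := Real.log_le_log (by linarith) (by linarith)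
  have hL1 : 1 ≤ L := by
    rw [hL, Real.le_log_iff_exp_le (by linarith)]
    linarith [Real.exp_one_lt_d9]
  have hL3 : L ≤ L ^ 3 := le_self_pow₀ hL1 (by norm_num)
  have hlogn : 1 / 2 ≤ Real.log n :=
    le_trans (by linarith [Real.log_two_gt_d9]) (Real.log_le_log (by norm_num) hn')
  have hpow : (m : ℝ) ^ S.opt = Real.exp (k * Real.log m) := by
    rw [hkdef, ← Real.log_pow, Real.exp_log (by positivity)]
  have hinv : 1 / (n : ℝ) ^ 2 = Real.exp (-(2 * Real.log n)) := by
    have h2 : 2 * Real.log n = Real.log ((n : ℝ) ^ 2) := by simp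
    rw [h2, Real.exp_neg, Real.exp_log (by positivity), one_div]
  rw [hpow, hinv, ← Real.exp_add]
  have hmain : k * Real.log m +
      -(ε / 2 * (6 * (Real.log n + L ^ 3 / ε) * k - k)) ≤ -(2 * Real.log n) := by
    -- Source of the constant 6: `3 * k * L ^ 3` pays once for `k log m` and twice for `log n`, and
    -- `6 log n ≥ 1` absorbs the `-k`.
    have he : ε / 2 * (6 * (Real.log n + L ^ 3 / ε) * k - k) =
        ε / 2 * k * (6 * Real.log n - 1) + 3 * (k * L ^ 3) := by
      field_simp
      ring
    have h1 : 0 ≤ ε / 2 * k * (6 * Real.log n - 1) :=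
      mul_nonneg (by positivity) (by linarith)
    have h2 : k * Real.log m ≤ k * L ^ 3 := by gcongr; exact hLm.trans hL3
    have h3 : L ≤ k * L ^ 3 := hL3.trans (le_mul_of_one_le_left (by positivity) hk)
    rw [he]
    linarith
  linarith [Real.exp_le_exp.2 hmain]
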